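/- **Theorem 3.11 (The frame transform).** *Conventions.* A pro-$C^*$-algebra is a complete Hausdorff complex topological $*$-algebra $A$ (not necessarily unital) whose topology is determined by the set $S(A)$ of its continuous $C^*$-seminorms. A Hilbert $A$-module is a right $A$-module $E$, compatible with a complex vector space structure, with an $A$-valued positive definite inner product $\langle\cdot,\cdot\rangle$ (linear in the second variable), complete for the seminorms $\bar p_E(\xi)=\sqrt{p(\langle\xi,\xi\rangle)}$, $p\in S(A)$. $L(E,F)$ is the set of adjointable module morphisms $E\to F$, $L(E)=L(E,E)$, and $b(L(E))$ is the set of those $T\in L(E)$ with $\sup_{p\in S(A)}\tilde p(T)<\infty$, where $\tilde p(T)$ is the least $M\ge 0$ with $\bar p_E(T\xi)\le M\,\bar p_E(\xi)$ for all $\xi$. The multiplier module is $M(E)=L(A,E)$, where $A$ is a Hilbert $A$-module with $\langle a,b\rangle=a^*b$; for $h\in M(E)$ and $\xi\in E$ put $\langle h,\xi\rangle=h^*(\xi)\in A$ and $\langle\xi,h\rangle=\langle h,\xi\rangle^*$. $E$ is countably generated in $M(E)$ if there is a sequence $(g_n)$ in $M(E)$ such that the closed submodule generated by $\{g_n(a):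 a\in A,\ n\ge 1\}$ is $E$. A sequence $(h_n)$ in $M(E)$ is a standard frame of multipliers in $E$ if there are constants $C,D>0$ such that for every $\xi\in E$ the series $\sum_n\langle\xi,h_n\rangle\langle h_n,\xi\rangle$ converges in $A$ and $$C\langle\xi,\xi\rangle\le\sum_n\langle\xi,h_n\rangle\langle h_n,\xi\rangle\le D\langle\xi,\xi\rangle .$$ $H_A$ is the Hilbert $A$-module of all sequences $(a_n)_n$ in $A$ such that $\sum_n a_n^*a_n$ converges in $A$, with $\langle (a_n)_n,(b_n)_n\rangle=\sum_n a_n^*b_n$, and $e_n\in M(H_A)$ maps $a\in A$ to the sequence whose $n$-th component is $a$ and whose other components are $0$. *Statement.* Let $A$ be a pro-$C^*$-algebra, let $E$ be a Hilbert $A$-module that is countably generated in $M(E)$, and let $(h_n)_n$ be a standard frame of multipliers in $E$. Then the frame transform $\theta:E\to H_A$, $\theta(\xi)=(\langle h_n,\xi\rangle)_n$, is an adjointable module morphism; it is an embedding (it is injective, and for every $p\in S(A)$ there are constants $c,M>0$ with $c\,\bar p_E(\xi)\le\bar p_{H_A}(\theta(\xi))\le M\,\bar p_E(\xi)$ for all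 $\xi\in E$) and its range is an orthogonal summand of $H_A$, that is, a submodule with $H_A=\theta(E)\oplus\theta(E)^\perp$; and $\theta^*\circ e_n=h_n$ for all $n$. Moreover, $\theta^*\circ\theta$ is an invertible element of $b(L(E))$, that is, it belongs to $b(L(E))$ and has an inverse in $b(L(E))$. -/

import Mathlib

open Filter Topology SummationFilter
open scoped RightActions NNReal ENNReal

namespace HilbertPro

universe u

/-! ### Completion of a seminormed non-unital `⋆`-algebra satisfying the `C⋆`-identity -/

section Representation

open UniformSpace UniformSpace.Completion IsDenseInducing

@[reducible] noncomputable def complMul (R : Type u) [NonUnitalSeminormedRing R] :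
    Mul (Completion R) :=
  ⟨Function.curry <| (isDenseInducing_coe.prodMap isDenseInducing_coe).extend
    ((↑) ∘ Function.uncurry ((· * ·) : R → R → R))⟩

attribute [local instance] complMul

theorem compl_coe_mul {R : Type u} [NonUnitalSeminormedRing R] (a b : R) :
    ((a * b : R) : Completion R) = a * b :=
  ((isDenseInducing_coe.prodMap isDenseInducing_coe).extend_eq
      ((continuous_coe R).comp (@continuous_mul R _ _ _)) (a, b)).symm

theorem compl_continuousMul (R : Type u) [NonUnitalSeminormedRing R] :
    ContinuousMul (Completion R) where
  continuous_mul := by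
    let m := (AddMonoidHom.mul : R →+ R →+ R).compr₂ toCompl
    have : Continuous fun q : R × R => m q.1 q.2 := (continuous_coe R).comp continuous_mul
    have di : IsDenseInducing (toCompl : R → Completion R) := isDenseInducing_coe
    exact (di.extend_Z_bilin di this :)

attribute [local instance] compl_continuousMul

@[reducible] noncomputable def complRing (R : Type u) [NonUnitalSeminormedRing R] :
    NonUnitalNormedRing (Completion R) :=
  { (inferInstance : NormedAddCommGroup (Completion R)),
    (inferInstance : Mul (Completion R)) with
    zero_mul a :=
      Completion.induction_on a (isClosed_eq (by fun_prop) continuous_const)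
        fun a => by rw [← coe_zero, ← compl_coe_mul, zero_mul]
    mul_zero a :=
      Completion.induction_on a (isClosed_eq (by fun_prop) continuous_const)
        fun a ↦ by rw [← coe_zero, ← compl_coe_mul, mul_zero]
    mul_assoc a b c :=
      Completion.induction_on₃ a b c (isClosed_eq (by fun_prop) (by fun_prop))
        fun a b c => by simp only [← compl_coe_mul, mul_assoc]
    left_distrib a b c :=
      Completion.induction_on₃ a b c (isClosed_eq (by fun_prop) (by fun_prop))
        fun a b c => by simp only [← coe_add, ← compl_coe_mul, mul_add]
    right_distrib a b c :=
      Completion.induction_on₃ a b c (isClosed_eq (by fun_prop) (by fun_prop))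
        fun a b c => by simp only [← coe_add, ← compl_coe_mul, add_mul]
    norm_mul_le a b :=
      Completion.induction_on₂ a b (isClosed_le (by fun_prop) (by fun_prop))
        fun a b => by simpa only [← compl_coe_mul, norm_coe] using norm_mul_le a b }

attribute [local instance] complRing

@[reducible] noncomputable def complStar (R : Type u) [NonUnitalSeminormedRing R] [StarRing R] :
    Star (Completion R) := ⟨Completion.map star⟩

attribute [local instance] complStar

theorem compl_continuousStar (R : Type u) [NonUnitalSeminormedRing R] [StarRing R] :
    ContinuousStar (Completion R) := ⟨Completion.continuous_map⟩

attribute [local instance] compl_continuousStar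

variable {R : Type u} [NonUnitalSeminormedRing R] [StarRing R] [NormedStarGroup R]

theorem compl_coe_star (a : R) : ((star a : R) : Completion R) = star ↑a :=
  (Completion.map_coe (uniformContinuous_addMonoidHom_of_continuous
    (f := (starAddEquiv : R ≃+ R).toAddMonoidHom) continuous_star) a).symm

@[reducible] noncomputable def complStarRing (R : Type u) [NonUnitalSeminormedRing R] [StarRing R]
    [NormedStarGroup R] : StarRing (Completion R) where
  star_involutive a :=
    Completion.induction_on a (isClosed_eq (by fun_prop) (by fun_prop))
      fun a => by simp only [← compl_coe_star, star_star]
  star_mul a b :=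
    Completion.induction_on₂ a b (isClosed_eq (by fun_prop) (by fun_prop))
      fun a b => by simp only [← compl_coe_mul, ← compl_coe_star, star_mul]
  star_add a b :=
    Completion.induction_on₂ a b (isClosed_eq (by fun_prop) (by fun_prop))
      fun a b => by simp only [← compl_coe_star, ← coe_add, star_add]

attribute [local instance] complStarRing

variable [NormedSpace ℂ R] [IsScalarTower ℂ R R] [SMulCommClass ℂ R R] [StarModule ℂ R]

@[reducible] noncomputable def complCStarAlgebra (h : ∀ a : R, ‖star a * a‖ = ‖a‖ ^ 2) :
    NonUnitalCStarAlgebra (Completion R) :=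
  { complRing R, complStarRing R, (inferInstance : NormedSpace ℂ (Completion R)) with
    complete := (inferInstance : CompleteSpace (Completion R)).complete
    norm_mul_self_le a :=
      Completion.induction_on a (isClosed_le (by fun_prop) (by fun_prop))
        fun a => by
          rw [← compl_coe_star, ← compl_coe_mul, norm_coe, norm_coe, ← sq]
          exact (h a).symm.le
    smul_assoc z a b := by
      refine Completion.induction_on₂ a b (isClosed_eq ?_ ?_) fun a b => ?_
      · exact (continuous_fst.const_smul z).mul continuous_snd
      · exact (continuous_fst.mul continuous_snd).const_smul z
      · simp only [smul_eq_mul, ← coe_smul, ← compl_coe_mul, smul_mul_assoc]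
    smul_comm z a b := by
      refine Completion.induction_on₂ a b (isClosed_eq ?_ ?_) fun a b => ?_
      · exact (continuous_fst.mul continuous_snd).const_smul z
      · exact continuous_fst.mul (continuous_snd.const_smul z)
      · simp only [smul_eq_mul, ← coe_smul, ← compl_coe_mul, mul_smul_comm]
    star_smul z a := by
      refine Completion.induction_on a (isClosed_eq ?_ ?_) fun a => ?_
      · exact (continuous_id.const_smul z).star
      · exact continuous_star.const_smul (star z)
      · simp only [← coe_smul, ← compl_coe_star, star_smul] }

theorem exists_isometric_representation (h : ∀ a : R, ‖star a * a‖ = ‖a‖ ^ 2) :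
    ∃ (B : Type u) (_ : NonUnitalCStarAlgebra B) (φ : R →⋆ₙₐ[ℂ] B), ∀ a, ‖φ a‖ = ‖a‖ :=
  ⟨Completion R, complCStarAlgebra h,
    letI := complCStarAlgebra h
    { toFun := fun a => (a : Completion R)
      map_smul' := fun z a => coe_smul z a
      map_zero' := coe_zero
      map_add' := fun a b => coe_add a b
      map_mul' := fun a b => compl_coe_mul a b
      map_star' := fun a => compl_coe_star a }, fun a => norm_coe a⟩

end Representation

/-- A `C⋆`-seminorm on a complex `⋆`-algebra. -/
structure CStarSeminorm (A : Type*) [NonUnitalRing A] [StarRing A] [Module ℂ A]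
    extends Seminorm ℂ A where
  mul_le' : ∀ a b : A, toFun (a * b) ≤ toFun a * toFun b
  star_mul_self' : ∀ a : A, toFun (star a * a) = toFun a ^ 2

namespace CStarSeminorm

theorem map_star {A : Type u} [NonUnitalRing A] [StarRing A] [Module ℂ A]
    (p : CStarSeminorm A) (a : A) : p.toSeminorm (star a) = p.toSeminorm a := by
  have key : ∀ b : A, p.toSeminorm b ≤ p.toSeminorm (star b) := by
    intro b
    have h1 : p.toSeminorm b ^ 2 ≤ p.toSeminorm (star b) * p.toSeminorm b := by
      have := p.mul_le' (star b) b
      rw [p.star_mul_self'] at this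
      exact this
    rcases (apply_nonneg p.toSeminorm b).eq_or_lt with h | h
    · rw [← h]; exact apply_nonneg _ _
    · nlinarith
  exact le_antisymm (by simpa using key (star a)) (key a)

/-- A copy of `A`, seen as a seminormed algebra for the seminorm `p`. -/
def Copy {A : Type u} [NonUnitalRing A] [StarRing A] [Module ℂ A] (_p : CStarSeminorm A) :
    Type u := A

section Representation

variable {A : Type u} [NonUnitalRing A] [StarRing A] [Module ℂ A] (p : CStarSeminorm A)

noncomputable instance : NonUnitalSeminormedRing p.Copy :=
  { (inferInstance : NonUnitalRing A),
    p.toSeminorm.toAddGroupSeminorm.toSeminormedAddCommGroup with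
    norm_mul_le := p.mul_le' }

noncomputable instance : StarRing p.Copy := inferInstanceAs (StarRing A)

instance : NormedStarGroup p.Copy := ⟨fun a => (p.map_star a).le⟩

noncomputable instance : NormedSpace ℂ p.Copy :=
  { (inferInstance : Module ℂ A) with
    norm_smul_le := fun z a => (map_smul_eq_mul p.toSeminorm z a).le }

/-- Every `C⋆`-seminorm is the norm of a `⋆`-homomorphism into a `C⋆`-algebra. -/
theorem exists_representation [hT : IsScalarTower ℂ A A] [hC : SMulCommClass ℂ A A]
    [hS : StarModule ℂ A] :
    ∃ (B : Type u) (_ : NonUnitalCStarAlgebra B) (φ : A →⋆ₙₐ[ℂ] B),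
      ∀ a, ‖φ a‖ = p.toSeminorm a :=
  haveI : IsScalarTower ℂ p.Copy p.Copy := hT
  haveI : SMulCommClass ℂ p.Copy p.Copy := hC
  haveI : StarModule ℂ p.Copy := hS
  exists_isometric_representation (R := p.Copy) (fun a => p.star_mul_self' a)

/-- A `C⋆`-seminorm is monotone on sums of squares. -/
theorem sum_star_mul_self_le [IsScalarTower ℂ A A] [SMulCommClass ℂ A A] [StarModule ℂ A]
    {ι : Type*} (s : Finset ι) (x y : ι → A) :
    p.toSeminorm (∑ i ∈ s, star (x i) * x i) ≤
      p.toSeminorm (∑ i ∈ s, star (x i) * x i + ∑ i ∈ s, star (y i) * y i) := by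
  obtain ⟨B, _, φ, hφ⟩ := p.exists_representation
  let _ := CStarAlgebra.spectralOrder B
  have := CStarAlgebra.spectralOrderedRing B
  have pos : ∀ z : ι → A, 0 ≤ φ (∑ i ∈ s, star (z i) * z i) := by
    intro z
    rw [map_sum]
    refine Finset.sum_nonneg fun i _ => ?_
    have h : φ (star (z i)) = star (φ (z i)) := StarHomClass.map_star φ (z i)
    rw [map_mul, h]
    exact star_mul_self_nonneg _
  rw [← hφ, ← hφ, map_add]
  exact CStarAlgebra.norm_le_norm_of_nonneg_of_le (pos x) (le_add_of_nonneg_right (pos y))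

end Representation

end CStarSeminorm

/-! ### Pro-`C⋆`-algebras -/

/-- The set `S(A)` of continuous `C⋆`-seminorms. -/
structure ContCStarSeminorm (A : Type*) [NonUnitalRing A] [StarRing A] [Module ℂ A]
    [TopologicalSpace A] extends CStarSeminorm A where
  continuous' : Continuous toFun

noncomputable instance (A : Type*) [NonUnitalRing A] [StarRing A] [Module ℂ A] [TopologicalSpace A] :
    CoeFun (ContCStarSeminorm A) fun _ => A → ℝ := ⟨fun p => p.toSeminorm⟩

/-- A pro-`C⋆`-algebra: a complete Hausdorff complex topological `⋆`-algebra, not necessarily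
unital, whose topology is determined by its continuous `C⋆`-seminorms. -/
class ProCStarAlgebra (A : Type*) extends NonUnitalRing A, StarRing A, Module ℂ A,
    IsScalarTower ℂ A A, SMulCommClass ℂ A A, StarModule ℂ A, UniformSpace A,
    IsUniformAddGroup A, CompleteSpace A, T2Space A where
  withSeminorms : WithSeminorms (fun p : ContCStarSeminorm A => p.toSeminorm)

namespace ProCStarAlgebra

variable {A : Type*} [ProCStarAlgebra A]

theorem tendsto_iff {ι : Type*} {l : Filter ι} {u : ι → A} {a : A} :
    Tendsto u l (𝓝 a) ↔
      ∀ (p : ContCStarSeminorm A) (ε : ℝ), 0 < ε → ∀ᶠ i in l, p (u i - a) < ε :=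
  withSeminorms.tendsto_nhds u a

theorem continuous_star : Continuous (star : A → A) := by
  rw [continuous_iff_continuousAt]
  intro a
  refine tendsto_iff.2 fun p ε hε => ?_
  filter_upwards [tendsto_iff.1 (tendsto_id (α := A) (x := 𝓝 a)) p ε hε] with b hb
  rw [← star_sub, p.map_star]
  exact hb

theorem continuous_mul_left (b : A) : Continuous fun a : A => b * a := by
  rw [continuous_iff_continuousAt]
  intro a
  refine tendsto_iff.2 fun p ε hε => ?_
  have hpos : 0 < p b + 1 := by have := apply_nonneg p.toSeminorm b; linarith
  filter_upwards [tendsto_iff.1 (tendsto_id (α := A) (x := 𝓝 a)) p (ε / (p b + 1))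
    (div_pos hε hpos)] with c hc
  rw [lt_div_iff₀ hpos] at hc
  have h1 : p (b * (c - a)) ≤ p b * p (c - a) := p.mul_le' b (c - a)
  have h2 := apply_nonneg p.toSeminorm (c - a)
  rw [← mul_sub]
  simp only [id] at hc
  nlinarith

theorem continuous_mul_right (b : A) : Continuous fun a : A => a * b := by
  have : (fun a : A => a * b) = fun a => star (star b * star a) := by
    funext a; simp
  rw [this]
  exact continuous_star.comp ((continuous_mul_left _).comp continuous_star)

theorem continuous_smul (z : ℂ) : Continuous fun a : A => z • a := by
  have : ContinuousSMul ℂ A := (withSeminorms (A := A)).continuousSMul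
  exact continuous_const_smul z

theorem cauchySeq_iff {u : ℕ → A} : CauchySeq u ↔ ∀ (p : ContCStarSeminorm A) (ε : ℝ), 0 < ε →
    ∃ N, ∀ m, N ≤ m → ∀ n, m ≤ n → p (u n - u m) < ε := by
  rw [_root_.cauchySeq_iff_tendsto, uniformity_eq_comap_nhds_zero, tendsto_comap_iff, tendsto_iff]
  refine forall₃_congr fun p ε hε => ?_
  rw [eventually_atTop]
  constructor
  · rintro ⟨⟨M, N⟩, h⟩
    refine ⟨max M N, fun m hm n hmn => ?_⟩
    have := h (m, n) ⟨le_trans (le_max_left _ _) hm, (le_trans (le_max_right _ _) hm).trans hmn⟩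
    simpa using this
  · rintro ⟨N, h⟩
    refine ⟨(N, N), ?_⟩
    rintro ⟨m, n⟩ ⟨hm, hn⟩
    rcases le_total m n with hmn | hmn
    · simpa using h m hm n hmn
    · have := h n hn m hmn
      rw [← map_neg_eq_map p.toSeminorm] at this
      simpa using this

/-- If `∑ xₙ⋆ xₙ + ∑ yₙ⋆ yₙ` converges, then so does `∑ xₙ⋆ xₙ`. -/
theorem exists_hasSum_of_add {x y : ℕ → A} {s : A}
    (h : HasSum (fun n => star (x n) * x n + star (y n) * y n) s (conditional ℕ)) :
    ∃ t, HasSum (fun n => star (x n) * x n) t (conditional ℕ) := by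
  simp only [HasSum, conditional_filter_eq_map_range, tendsto_map'_iff, Function.comp_def] at h ⊢
  refine cauchySeq_tendsto_of_complete ?_
  have hcau := h.cauchySeq
  rw [cauchySeq_iff] at hcau ⊢
  intro p ε hε
  obtain ⟨N, hN⟩ := hcau p ε hε
  refine ⟨N, fun m hm n hmn => lt_of_le_of_lt ?_ (hN m hm n hmn)⟩
  rw [← Finset.sum_Ico_eq_sub _ hmn, ← Finset.sum_Ico_eq_sub _ hmn, Finset.sum_add_distrib]
  exact p.sum_star_mul_self_le _ x y

end ProCStarAlgebra

/-! ### Hilbert modules -/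

/-- A right `A`-module, compatible with the complex structure, with an `A`-valued Hermitian form,
linear in the second variable. The action of `a` on `ξ` is written `ξ <• a`. -/
class InnerRightModule (A : Type*) (E : Type*) [ProCStarAlgebra A] [AddCommGroup E] [Module ℂ E]
    extends Inner A E, SMul Aᵐᵒᵖ E where
  add_act : ∀ (ξ η : E) (a : A), (ξ + η) <• a = ξ <• a + η <• a
  act_add : ∀ (ξ : E) (a b : A), ξ <• (a + b) = ξ <• a + ξ <• b
  act_mul : ∀ (ξ : E) (a b : A), ξ <• (a * b) = (ξ <• a) <• b
  smul_act : ∀ (z : ℂ) (ξ : E) (a : A), (z • ξ) <• a = z • (ξ <• a)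
  act_smul : ∀ (z : ℂ) (ξ : E) (a : A), ξ <• (z • a) = z • (ξ <• a)
  inner_add_right : ∀ ξ η ζ : E, inner ξ (η + ζ) = inner ξ η + inner ξ ζ
  inner_smul_right : ∀ (z : ℂ) (ξ η : E), inner ξ (z • η) = z • inner ξ η
  inner_act_right : ∀ (ξ η : E) (a : A), inner ξ (η <• a) = inner ξ η * a
  star_inner : ∀ ξ η : E, star (inner ξ η) = inner η ξ

/-- The seminorm `ξ ↦ √p(⟨ξ, ξ⟩)` on a module with an `A`-valued inner product. -/
noncomputable def ContCStarSeminorm.bar {A E : Type*} [ProCStarAlgebra A] [AddCommGroup E]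
    [Module ℂ E] [InnerRightModule A E] (p : ContCStarSeminorm A) (ξ : E) : ℝ :=
  √(p (inner A ξ ξ))

/-- A Hilbert `A`-module: the form is positive definite, and the module is complete for the
topology determined by the seminorms `ξ ↦ √p(⟨ξ, ξ⟩)`, where `p` runs over `S(A)`. (The set `S(A)`
is directed, so that the balls of single seminorms form a basis of neighbourhoods of `0`.) -/
class HilbertModule (A : Type*) (E : Type*) [ProCStarAlgebra A] [PartialOrder A]
    [StarOrderedRing A] [AddCommGroup E] [Module ℂ E] [UniformSpace E]
    extends InnerRightModule A E, IsUniformAddGroup E, CompleteSpace E where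
  inner_self_nonneg : ∀ ξ : E, 0 ≤ inner ξ ξ
  inner_self_eq_zero : ∀ ξ : E, inner ξ ξ = 0 ↔ ξ = 0
  nhds_zero_hasBasis : (𝓝 (0 : E)).HasBasis (fun i : ContCStarSeminorm A × ℝ => 0 < i.2)
    fun i => {ξ | i.1.bar ξ < i.2}

/-- The module `A` over itself, with `⟨a, b⟩ = a⋆ b`. -/
instance (priority := low) selfInnerRightModule (A : Type*) [ProCStarAlgebra A] :
    InnerRightModule A A where
  inner a b := star a * b
  add_act ξ η a := add_mul ξ η a
  act_add ξ a b := mul_add ξ a b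
  act_mul ξ a b := (mul_assoc ξ a b).symm
  smul_act z ξ a := smul_mul_assoc z ξ a
  act_smul z ξ a := mul_smul_comm z ξ a
  inner_add_right _ _ _ := mul_add _ _ _
  inner_smul_right z ξ η := mul_smul_comm z (star ξ) η
  inner_act_right ξ η a := (mul_assoc (star ξ) η a).symm
  star_inner ξ η := by simp

/-! ### The standard Hilbert module `H_A` -/

section HA

variable (A : Type*) [ProCStarAlgebra A]

/-- The sequences `(aₙ)` such that `∑ aₙ⋆ aₙ` converges in `A`. -/
def squareSummable : Submodule ℂ (ℕ → A) where
  carrier := {a | ∃ s, HasSum (fun n => star (a n) * a n) s (conditional ℕ)}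
  zero_mem' := ⟨0, by simp⟩
  add_mem' := by
    rintro a b ⟨s, hs⟩ ⟨t, ht⟩
    have h := ((hs.add hs).add (ht.add ht))
    refine ProCStarAlgebra.exists_hasSum_of_add (y := a - b) (s := s + s + (t + t)) ?_
    convert h using 2 with n
    simp only [Pi.add_apply, Pi.sub_apply, star_add, star_sub]
    noncomm_ring
  smul_mem' := by
    rintro z a ⟨s, hs⟩
    refine ⟨(star z * z) • s, ?_⟩
    have := hs.map (AddMonoidHom.mk' (fun b : A => (star z * z) • b) fun _ _ => smul_add _ _ _)
      (ProCStarAlgebra.continuous_smul _)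
    refine (congrArg (HasSum · _ _) (funext fun n => ?_)).mp this
    simp [smul_mul_smul_comm]

/-- The Hilbert module `H_A` of all sequences `(aₙ)` in `A` such that `∑ aₙ⋆ aₙ` converges. -/
def HA : Type _ := squareSummable A

namespace HA

variable {A}

noncomputable instance : AddCommGroup (HA A) := inferInstanceAs (AddCommGroup (squareSummable A))
noncomputable instance : Module ℂ (HA A) := inferInstanceAs (Module ℂ (squareSummable A))

/-- The sequence underlying an element of `H_A`. -/
def toSeq (x : HA A) : ℕ → A := Subtype.val (p := fun a => a ∈ squareSummable A) x

instance : CoeFun (HA A) fun _ => ℕ → A := ⟨toSeq⟩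

/-- The element of `H_A` given by a sequence `(aₙ)` such that `∑ aₙ⋆ aₙ` converges. -/
def mk (a : ℕ → A) (ha : ∃ s, HasSum (fun n => star (a n) * a n) s (conditional ℕ)) : HA A :=
  Subtype.mk (p := fun a => a ∈ squareSummable A) a ha

theorem exists_hasSum (x : HA A) :
    ∃ s, HasSum (fun n => star (x n) * x n) s (conditional ℕ) :=
  Subtype.property (p := fun a => a ∈ squareSummable A) x

theorem mk_apply (a : ℕ → A) (ha) (n : ℕ) : mk a ha n = a n := rfl

theorem ext {x y : HA A} (h : ∀ n, x n = y n) : x = y := Subtype.ext (funext h)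

theorem add_apply (x y : HA A) (n : ℕ) : (x + y) n = x n + y n := rfl
theorem smul_apply (z : ℂ) (x : HA A) (n : ℕ) : (z • x) n = z • x n := rfl

/-- The series defining the inner product of `H_A` converges. -/
theorem summable_inner (x y : HA A) :
    Summable (fun n => star (x n) * y n) (conditional ℕ) := by
  have key : ∀ c d : ℂ, ∃ t, HasSum
      (fun n => d • (star (x n + c • y n) * (x n + c • y n))) t (conditional ℕ) := by
    intro c d
    obtain ⟨t, ht⟩ := (x + c • y).exists_hasSum
    exact ⟨d • t, ht.map (AddMonoidHom.mk' (fun b : A => d • b) fun _ _ => smul_add _ _ _)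
      (ProCStarAlgebra.continuous_smul _)⟩
  obtain ⟨s, hs⟩ := key 1 (1 / 4)
  obtain ⟨t, ht⟩ := key (-1) (-1 / 4)
  obtain ⟨u, hu⟩ := key Complex.I (-Complex.I / 4)
  obtain ⟨v, hv⟩ := key (-Complex.I) (Complex.I / 4)
  refine ⟨s + t + (u + v), ?_⟩
  refine (congrArg (HasSum · _ _) (funext fun n => ?_)).mp ((hs.add ht).add (hu.add hv))
  simp only [star_add, star_smul, add_mul, mul_add, smul_mul_assoc, mul_smul_comm, smul_add,
    smul_smul, RCLike.star_def, map_one, map_neg, Complex.conj_I]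
  match_scalars <;> ring_nf <;> simp
  ring

noncomputable instance : InnerRightModule A (HA A) where
  inner x y := ∑'[conditional ℕ] n, star (x n) * y n
  smul a x := mk (fun n => x n * a.unop) <| by
    obtain ⟨s, hs⟩ := x.exists_hasSum
    refine ⟨star a.unop * s * a.unop, ?_⟩
    have := hs.map (AddMonoidHom.mk' (fun b : A => star a.unop * b * a.unop)
      fun _ _ => by noncomm_ring) ((ProCStarAlgebra.continuous_mul_right _).comp
        (ProCStarAlgebra.continuous_mul_left _))
    refine (congrArg (HasSum · _ _) (funext fun n => ?_)).mp this
    simp [mul_assoc]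
  add_act x y a := ext fun n => add_mul (x n) (y n) a
  act_add x a b := ext fun n => mul_add (x n) a b
  act_mul x a b := ext fun n => (mul_assoc (x n) a b).symm
  smul_act z x a := ext fun n => smul_mul_assoc z (x n) a
  act_smul z x a := ext fun n => mul_smul_comm z (x n) a
  inner_add_right x y w := by
    simp only [add_apply, mul_add]
    exact (summable_inner x y).tsum_add (summable_inner x w)
  inner_smul_right z x y := by
    have := (summable_inner x y).hasSum.map
      (AddMonoidHom.mk' (fun b : A => z • b) fun _ _ => smul_add _ _ _)
      (ProCStarAlgebra.continuous_smul _)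
    refine Eq.trans ?_ (HasSum.tsum_eq this)
    refine tsum_congr fun n => ?_
    exact mul_smul_comm z (star (x n)) (y n)
  inner_act_right x y a := by
    have := (summable_inner x y).hasSum.map
      (AddMonoidHom.mk' (fun b : A => b * a) fun _ _ => add_mul _ _ _)
      (ProCStarAlgebra.continuous_mul_right _)
    refine Eq.trans ?_ (HasSum.tsum_eq this)
    refine tsum_congr fun n => ?_
    exact (mul_assoc _ _ _).symm
  star_inner x y := by
    have := (summable_inner x y).hasSum.map
      (AddMonoidHom.mk' (fun b : A => star b) fun _ _ => star_add _ _)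
      ProCStarAlgebra.continuous_star
    refine Eq.trans (HasSum.tsum_eq this).symm ?_
    refine tsum_congr fun n => ?_
    simp

theorem inner_def (x y : HA A) : inner A x y = ∑'[conditional ℕ] n, star (x n) * y n := rfl

end HA

end HA

/-! ### Adjointable morphisms, multipliers and frames -/

section Adjointable

variable {A : Type*} [ProCStarAlgebra A]

/-- The space `L(E, F)` of adjointable module morphisms. An element is a module morphism `T`
together with its adjoint `T⋆` (in Hilbert modules the adjoint is determined by `T`). -/
structure Adjointable (A : Type*) (E F : Type*) [ProCStarAlgebra A]
    [AddCommGroup E] [Module ℂ E] [InnerRightModule A E]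
    [AddCommGroup F] [Module ℂ F] [InnerRightModule A F] where
  toLinearMap : E →ₗ[ℂ] F
  adj : F →ₗ[ℂ] E
  map_act' : ∀ (ξ : E) (a : A), toLinearMap (ξ <• a) = toLinearMap ξ <• a
  adj_act' : ∀ (η : F) (a : A), adj (η <• a) = adj η <• a
  inner_adj' : ∀ (ξ : E) (η : F), inner A (toLinearMap ξ) η = inner A ξ (adj η)

namespace Adjointable

variable {E F G : Type*} [AddCommGroup E] [Module ℂ E] [InnerRightModule A E]
  [AddCommGroup F] [Module ℂ F] [InnerRightModule A F]
  [AddCommGroup G] [Module ℂ G] [InnerRightModule A G]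

instance : CoeFun (Adjointable A E F) fun _ => E → F := ⟨fun T => T.toLinearMap⟩

/-- The adjoint `T⋆`, as an element of `L(F, E)`. -/
def adjoint (T : Adjointable A E F) : Adjointable A F E where
  toLinearMap := T.adj
  adj := T.toLinearMap
  map_act' := T.adj_act'
  adj_act' := T.map_act'
  inner_adj' η ξ := by
    rw [← InnerRightModule.star_inner, ← T.inner_adj', InnerRightModule.star_inner]

/-- The composition `S ∘ T`. -/
def comp (S : Adjointable A F G) (T : Adjointable A E F) : Adjointable A E G where
  toLinearMap := S.toLinearMap ∘ₗ T.toLinearMap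
  adj := T.adj ∘ₗ S.adj
  map_act' ξ a := by simp [T.map_act', S.map_act']
  adj_act' ξ a := by simp [T.adj_act', S.adj_act']
  inner_adj' ξ η := by simp [T.inner_adj', S.inner_adj']

variable (A E) in
/-- The identity of `L(E)`. -/
def id : Adjointable A E E where
  toLinearMap := LinearMap.id
  adj := LinearMap.id
  map_act' _ _ := rfl
  adj_act' _ _ := rfl
  inner_adj' _ _ := rfl

/-- The seminorm `p` of `L(E, F)`: the operator norm of the map induced by `T` from
`E / ker p` to `F / ker p`, that is, the least `M` such that `p(T ξ) ≤ M p(ξ)` for all `ξ`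
(with value `∞` if there is no such `M`). -/
noncomputable def opSeminorm (p : ContCStarSeminorm A) (T : Adjointable A E F) : ℝ≥0∞ :=
  ⨅ (M : ℝ≥0) (_ : ∀ ξ, p.bar (A := A) (T ξ) ≤ M * p.bar (A := A) ξ), (M : ℝ≥0∞)

/-- The bounded part `b(L(E, F))`: the seminorms of `T` have a finite supremum. -/
def boundedPart (A E F : Type*) [ProCStarAlgebra A]
    [AddCommGroup E] [Module ℂ E] [InnerRightModule A E]
    [AddCommGroup F] [Module ℂ F] [InnerRightModule A F] : Set (Adjointable A E F) :=
  {T | ⨆ p : ContCStarSeminorm A, opSeminorm p T < ∞}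

/-- `T` is an invertible element of the algebra `b(L(E))`. -/
def IsInvertibleInBoundedPart (T : Adjointable A E E) : Prop :=
  T ∈ boundedPart A E E ∧
    ∃ S ∈ boundedPart A E E, S.comp T = Adjointable.id A E ∧ T.comp S = Adjointable.id A E

/-- `T` is injective, and both `T` and its inverse `T(E) → E` are continuous, that is, bounded
for each seminorm `p ∈ S(A)`. -/
def IsEmbedding (T : Adjointable A E F) : Prop :=
  Function.Injective T ∧
    (∀ p : ContCStarSeminorm A, ∃ M : ℝ, 0 < M ∧
      ∀ ξ, p.bar (A := A) (T ξ) ≤ M * p.bar (A := A) ξ) ∧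
    ∀ p : ContCStarSeminorm A, ∃ M : ℝ, 0 < M ∧
      ∀ ξ, p.bar (A := A) ξ ≤ M * p.bar (A := A) (T ξ)

end Adjointable

section Complement

variable {F : Type*} [AddCommGroup F] [Module ℂ F] [InnerRightModule A F]

variable (A) in
/-- The orthogonal complement `{η | ⟨ξ, η⟩ = 0 for all ξ ∈ G}`. -/
def orthogonalComplement (G : Submodule ℂ F) : Submodule ℂ F where
  carrier := {η | ∀ ξ ∈ G, inner A ξ η = 0}
  zero_mem' ξ _ := by
    have := InnerRightModule.inner_smul_right (A := A) 0 ξ (0 : F)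
    simpa using this
  add_mem' hη hζ ξ hξ := by rw [InnerRightModule.inner_add_right, hη ξ hξ, hζ ξ hξ, add_zero]
  smul_mem' z η hη ξ hξ := by rw [InnerRightModule.inner_smul_right, hη ξ hξ, smul_zero]

variable (A) in
/-- `G` is an `A`-submodule of `F` and `F` is the direct sum of `G` and its orthogonal
complement. -/
def IsOrthogonalSummand (G : Submodule ℂ F) : Prop :=
  (∀ ξ ∈ G, ∀ a : A, ξ <• a ∈ G) ∧ IsCompl G (orthogonalComplement A G)

end Complement

variable {E : Type*} [AddCommGroup E] [Module ℂ E]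

/-- The multiplier module `M(E) = L(A, E)`. -/
abbrev Multiplier (A E : Type*) [ProCStarAlgebra A] [AddCommGroup E] [Module ℂ E]
    [InnerRightModule A E] := Adjointable A A E

/-- The element `⟨h, ξ⟩ = h⋆(ξ)` of `A`, for `h ∈ M(E)` and `ξ ∈ E`. -/
def Multiplier.pairing [InnerRightModule A E] (h : Multiplier A E) (ξ : E) : A := h.adjoint ξ

variable (A E) in
/-- `E` is countably generated in `M(E)`: for some sequence `(hₙ)` in `M(E)`, the closed submodule
generated by the elements `hₙ · a = hₙ(a)`, `a ∈ A`, is `E`. (Since `hₙ(a) b = hₙ(a b)`, the complex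
linear span of these elements is a submodule.) -/
def IsCountablyGeneratedInMultipliers [UniformSpace E] [InnerRightModule A E] : Prop :=
  ∃ h : ℕ → Multiplier A E,
    Dense (Submodule.span ℂ {ξ : E | ∃ (n : ℕ) (a : A), ξ = h n a} : Set E)

/-- `(hₙ)` is a standard frame of multipliers in `E`: for some constants `C, D > 0` and all `ξ ∈ E`,
the series `∑ ⟨ξ, hₙ⟩⟨hₙ, ξ⟩` converges in `A` and `C ⟨ξ, ξ⟩ ≤ ∑ ⟨ξ, hₙ⟩⟨hₙ, ξ⟩ ≤ D ⟨ξ, ξ⟩`. Here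
`⟨ξ, hₙ⟩ = ⟨hₙ, ξ⟩⋆`, and convergence is convergence of the sequence of partial sums. -/
def IsStandardFrame [PartialOrder A] [InnerRightModule A E] (h : ℕ → Multiplier A E) : Prop :=
  ∃ C D : ℝ, 0 < C ∧ 0 < D ∧ ∀ ξ : E, ∃ s : A,
    HasSum (fun n => star ((h n).pairing ξ) * (h n).pairing ξ) s (conditional ℕ) ∧
      (C : ℂ) • inner A ξ ξ ≤ s ∧ s ≤ (D : ℂ) • inner A ξ ξ

/-- The frame transform `θ : E → H_A`, `θ(ξ) = (⟨hₙ, ξ⟩)ₙ`, of a standard frame of multipliers. -/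
def frameTransform [PartialOrder A] [InnerRightModule A E] (h : ℕ → Multiplier A E)
    (hh : IsStandardFrame h) (ξ : E) : HA A :=
  HA.mk (fun n => (h n).pairing ξ) <| by
    obtain ⟨C, D, -, -, H⟩ := hh
    obtain ⟨s, hs, -⟩ := H ξ
    exact ⟨s, hs⟩

/-- The multiplier `eₙ ∈ M(H_A)`: `eₙ(a)` has `n`-th component `a` and all other components `0`,
and `eₙ⋆(x) = xₙ`. -/
noncomputable def HA.e (n : ℕ) : Multiplier A (HA A) where
  toLinearMap :=
    { toFun := fun a => HA.mk (Pi.single n a) ⟨star a * a, by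
        have := hasSum_single (L := conditional ℕ)
          (f := fun m => star ((Pi.single n a : ℕ → A) m) * (Pi.single n a : ℕ → A) m) n
          fun m hm => by simp [Pi.single_eq_of_ne hm]
        simpa using this⟩
      map_add' := fun a b => HA.ext fun m =>
        congrFun (Pi.single_add (f := fun _ : ℕ => A) n a b) m
      map_smul' := fun z a => HA.ext fun m =>
        congrFun (Pi.single_smul (f := fun _ : ℕ => A) n z a) m }
  adj :=
    { toFun := fun x => x n
      map_add' := fun _ _ => rfl
      map_smul' := fun _ _ => rfl }
  map_act' b a := HA.ext fun m => by
    change (Pi.single n (b * a) : ℕ → A) m = (Pi.single n b : ℕ → A) m * a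
    rcases eq_or_ne m n with rfl | hm
    · simp
    · simp [Pi.single_eq_of_ne hm]
  adj_act' _ _ := rfl
  inner_adj' a x := by
    change ∑'[conditional ℕ] m, star ((Pi.single n a : ℕ → A) m) * x m = star a * x n
    have := hasSum_single (L := conditional ℕ)
      (f := fun m => star ((Pi.single n a : ℕ → A) m) * x m) n
      fun m hm => by simp [Pi.single_eq_of_ne hm]
    simpa using this.tsum_eq

end Adjointable

end HilbertPro

open HilbertPro

/-! The frame inequality says that C ≤ θ⋆θ ≤ D as forms on E. Two points need work: that θ has an
adjoint, and that θ⋆θ has an inverse bounded uniformly in p ∈ S(A).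

The adjoint is forced to be θ⋆x = ∑ hₙ(xₙ). If ζ is a finite part of this sum and y the matching
truncation of x, then ⟨ζ, ζ⟩ = ⟨θζ, y⟩. Cauchy–Schwarz and the upper frame bound give p̄(ζ) ≤ √D
p̄(y) (`bar_sum_frame_sq_le`), so the partial sums are Cauchy and converge by completeness of E.

For the inverse (`isInvertibleInBoundedPart`), put S = 1 - D⁻¹θ⋆θ, so that 0 ≤ S ≤ 1 - C/D.
Cauchy–Schwarz for the form ⟨ξ, Sη⟩ turns this into a contraction of every p̄ by the same factor 1 -
C/D (`bar_le_of_nonneg_of_le`), and the Neumann series converges in E (`exists_sub_eq`).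
Surjectivity of θ⋆θ then splits any x as θξ + (x - θξ) with θ⋆(x - θξ) = 0, which makes the range a
summand.

Positivity is tested one seminorm at a time, after representing A in a C⋆-algebra whose norm pulls
back to p. This reduces the estimates to C⋆-algebra inequalities, and the resulting notion `Nonneg`
passes to limits. -/

open HilbertPro

namespace HilbertPro

universe u v

section

/-! ### Positivity relative to one C⋆-seminorm. -/

namespace ContCStarSeminorm

variable {A : Type u} [ProCStarAlgebra A] (p : ContCStarSeminorm A)

/-- `a` is positive in the `C⋆`-algebra associated with `p`. -/
def Nonneg (a : A) : Prop :=
  ∀ (B : Type u) [NonUnitalCStarAlgebra B] [PartialOrder B] [StarOrderedRing B]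
    (φ : A →⋆ₙₐ[ℂ] B), (∀ b, ‖φ b‖ = p b) → 0 ≤ φ a

variable {p}

/-- In a star-ordered ring the positive elements are the finite sums of elements s⋆s, and a
⋆-homomorphism preserves such sums. -/
theorem Nonneg.of_nonneg [PartialOrder A] [StarOrderedRing A] {a : A} (ha : 0 ≤ a) :
    p.Nonneg a := by
  intro B _ _ _ φ _
  rw [StarOrderedRing.nonneg_iff] at ha
  induction ha using AddSubmonoid.closure_induction with
  | mem x hx =>
    obtain ⟨s, rfl⟩ := hx
    simp only [map_mul, map_star]
    exact star_mul_self_nonneg _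
  | zero => simp
  | add x y _ _ hx hy => rw [map_add]; exact add_nonneg hx hy

theorem Nonneg.star_mul_self (a : A) : p.Nonneg (star a * a) := by
  intro B _ _ _ φ _
  simp only [map_mul, map_star]
  exact star_mul_self_nonneg _

theorem Nonneg.add {a b : A} (ha : p.Nonneg a) (hb : p.Nonneg b) : p.Nonneg (a + b) := by
  intro B _ _ _ φ h
  rw [map_add]
  exact add_nonneg (ha B φ h) (hb B φ h)

theorem Nonneg.sum {ι : Type*} (s : Finset ι) (f : ι → A) (h : ∀ i ∈ s, p.Nonneg (f i)) :
    p.Nonneg (∑ i ∈ s, f i) := by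
  intro B _ _ _ φ hφ
  rw [map_sum]
  exact Finset.sum_nonneg fun i hi => h i hi B φ hφ

theorem Nonneg.smul {t : ℝ} (ht : 0 ≤ t) {a : A} (ha : p.Nonneg a) :
    p.Nonneg ((t : ℂ) • a) := by
  intro B _ _ _ φ h
  rw [map_smul]
  have := smul_nonneg ht (ha B φ h)
  rwa [Complex.coe_smul]

/-- This is b⋆ab ≤ ‖a‖ b⋆b, read in B; it supplies the noncommutative step of Cauchy–Schwarz. -/
theorem Nonneg.smul_sub_star_mul_mul {a : A} (ha : p.Nonneg a) (b : A) :
    p.Nonneg ((p a : ℂ) • (star b * b) - star b * a * b) := by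
  intro B _ _ _ φ h
  have := CStarAlgebra.star_left_conjugate_le_norm_smul (a := φ b) (b := φ a)
    (IsSelfAdjoint.of_nonneg (ha B φ h))
  rw [h] at this
  rw [map_sub, map_smul, Complex.coe_smul, sub_nonneg]
  simpa only [map_mul, map_star] using this

/-- `Nonneg` quantifies over all representations, so an actual one is needed to extract information.
There the norm is monotone on positive elements. -/
theorem Nonneg.le_add {a b : A} (ha : p.Nonneg a) (hb : p.Nonneg b) : p a ≤ p (a + b) := by
  obtain ⟨B, _, φ, hφ⟩ := p.exists_representation
  let _ := CStarAlgebra.spectralOrder B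
  have := CStarAlgebra.spectralOrderedRing B
  rw [← hφ, ← hφ, map_add]
  exact CStarAlgebra.norm_le_norm_of_nonneg_of_le (ha B φ hφ)
    (le_add_of_nonneg_right (hb B φ hφ))

theorem Nonneg.le_of_sub {a b : A} (ha : p.Nonneg a) (hb : p.Nonneg (b - a)) : p a ≤ p b := by
  simpa using ha.le_add hb

/-- Since ‖φ b‖ = p b, the map φ is continuous, and the positive cone of a C⋆-algebra is closed. -/
theorem Nonneg.of_tendsto {ι : Type*} {l : Filter ι} [l.NeBot] {f : ι → A} {a : A}
    (hf : Tendsto f l (𝓝 a)) (h : ∀ i, p.Nonneg (f i)) : p.Nonneg a := by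
  intro B _ _ _ φ hφ
  have : Tendsto (fun i => φ (f i)) l (𝓝 (φ a)) := by
    rw [Metric.tendsto_nhds]
    intro ε hε
    filter_upwards [ProCStarAlgebra.tendsto_iff.1 hf p ε hε] with i hi
    rwa [dist_eq_norm, ← map_sub, hφ]
  exact ge_of_tendsto' this fun i => h i B φ hφ

theorem apply_smul_of_nonneg {t : ℝ} (ht : 0 ≤ t) (a : A) : p ((t : ℂ) • a) = t * p a := by
  rw [map_smul_eq_mul]; simp [abs_of_nonneg ht]

end ContCStarSeminorm

theorem ProCStarAlgebra.eq_zero_of_forall {A : Type u} [ProCStarAlgebra A] {a : A}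
    (h : ∀ p : ContCStarSeminorm A, p a = 0) : a = 0 := by
  refine tendsto_nhds_unique (f := fun _ : ℕ => a) (l := atTop) tendsto_const_nhds ?_
  refine ProCStarAlgebra.tendsto_iff.2 fun p ε hε => ?_
  exact Eventually.of_forall fun _ => by simpa [h p] using hε

/-! ### The A-valued form and Cauchy–Schwarz. -/

namespace InnerRightModule

variable {A : Type u} [ProCStarAlgebra A] {E : Type v} [AddCommGroup E] [Module ℂ E]
  [InnerRightModule A E]

theorem inner_add_left (ξ η ζ : E) : inner A (ξ + η) ζ = inner A ξ ζ + inner A η ζ := by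
  rw [← star_inner, inner_add_right, star_add, star_inner, star_inner]

theorem inner_smul_left (z : ℂ) (ξ η : E) : inner A (z • ξ) η = star z • inner A ξ η := by
  rw [← star_inner, inner_smul_right, star_smul, star_inner]

theorem inner_act_left (ξ η : E) (a : A) : inner A (ξ <• a) η = star a * inner A ξ η := by
  rw [← star_inner, inner_act_right, star_mul, star_inner]

variable (A) in
/-- The map `η ↦ ⟨ξ, η⟩`. -/
def innerHom (ξ : E) : E →ₗ[ℂ] A where
  toFun η := inner A ξ η
  map_add' := inner_add_right ξ
  map_smul' z η := inner_smul_right z ξ η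

theorem inner_sub_right (ξ η ζ : E) : inner A ξ (η - ζ) = inner A ξ η - inner A ξ ζ :=
  map_sub (innerHom A ξ) η ζ

theorem inner_zero_right (ξ : E) : inner A ξ (0 : E) = 0 := map_zero (innerHom A ξ)

theorem inner_sum_right {ι : Type*} (s : Finset ι) (ξ : E) (f : ι → E) :
    inner A ξ (∑ i ∈ s, f i) = ∑ i ∈ s, inner A ξ (f i) := map_sum (innerHom A ξ) f s

theorem inner_sub_left (ξ η ζ : E) : inner A (ξ - η) ζ = inner A ξ ζ - inner A η ζ := by
  rw [← star_inner, inner_sub_right, star_sub, star_inner, star_inner]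

end InnerRightModule

namespace ContCStarSeminorm

variable {A : Type u} [ProCStarAlgebra A] {p : ContCStarSeminorm A} {E : Type v}
  [AddCommGroup E] [Module ℂ E] [InnerRightModule A E]

theorem bar_sq (ξ : E) : p.bar (A := A) ξ ^ 2 = p (inner A ξ ξ) :=
  Real.sq_sqrt (apply_nonneg p.toSeminorm _)

theorem bar_nonneg (ξ : E) : 0 ≤ p.bar (A := A) ξ := Real.sqrt_nonneg _

theorem bar_smul (z : ℂ) (ξ : E) : p.bar (A := A) (z • ξ) = ‖z‖ * p.bar (A := A) ξ := by
  rw [bar, bar, InnerRightModule.inner_smul_left, InnerRightModule.inner_smul_right, smul_smul,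
    map_smul_eq_mul]
  have : ‖star z * z‖ = ‖z‖ ^ 2 := by simp [sq]
  rw [this, Real.sqrt_mul (sq_nonneg _), Real.sqrt_sq (norm_nonneg _)]

theorem bar_neg (ξ : E) : p.bar (A := A) (-ξ) = p.bar (A := A) ξ := by
  simpa using bar_smul (p := p) (-1) ξ

/-- The Cauchy–Schwarz inequality. -/
theorem inner_sq_le (hpos : ∀ ξ : E, p.Nonneg (inner A ξ ξ)) (ξ η : E) :
    p (inner A ξ η) ^ 2 ≤ p (inner A ξ ξ) * p (inner A η η) := by
  set c := inner A ξ η with hc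
  set K := p (inner A ξ ξ) with hK
  have hc' : inner A η ξ = star c := (InnerRightModule.star_inner ξ η).symm
  -- M stands in for K = p⟨ξ, ξ⟩, which may vanish and could not be divided by. With c = ⟨ξ, η⟩,
  -- expand the square of Mη - ξc, bound c⋆⟨ξ, ξ⟩c by K c⋆c, and use K ≤ M: what remains is M(M⟨η,
  -- η⟩ - c⋆c).
  have main : ∀ M : ℝ, 0 < M → K ≤ M → p c ^ 2 ≤ M * p (inner A η η) := by
    intro M hM hKM
    have h1 := hpos ((M : ℂ) • η - ξ <• c)
    have h2 := (hpos ξ).smul_sub_star_mul_mul c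
    have h3 := (Nonneg.star_mul_self (p := p) c).smul (sub_nonneg.2 hKM)
    have h4 := (h1.add h2).add h3
    have h5 : inner A ((M : ℂ) • η - ξ <• c) ((M : ℂ) • η - ξ <• c) +
        ((K : ℂ) • (star c * c) - star c * inner A ξ ξ * c) +
          ((M - K : ℝ) : ℂ) • (star c * c) =
        (M : ℂ) • ((M : ℂ) • inner A η η - star c * c) := by
      simp only [InnerRightModule.inner_sub_left, InnerRightModule.inner_sub_right,
        InnerRightModule.inner_smul_left, InnerRightModule.inner_smul_right,
        InnerRightModule.inner_act_left, InnerRightModule.inner_act_right, hc', ← hc,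
        Complex.star_def, Complex.conj_ofReal, sub_mul, smul_mul_assoc, Complex.ofReal_sub,
        mul_assoc]
      module
    rw [← hK, h5] at h4
    have h6 : p.Nonneg ((M : ℂ) • inner A η η - star c * c) := by
      have := h4.smul (inv_nonneg.2 hM.le)
      rwa [Complex.ofReal_inv, inv_smul_smul₀ (by exact_mod_cast hM.ne')] at this
    have h7 := (Nonneg.star_mul_self c).le_of_sub h6
    rw [apply_smul_of_nonneg hM.le] at h7
    exact (p.star_mul_self' c).symm.le.trans h7
  have hK0 : 0 ≤ K := apply_nonneg p.toSeminorm _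
  -- Take M = K + ε and let ε decrease to 0.
  refine ge_of_tendsto (x := 𝓝[>] (0 : ℝ)) (f := fun ε => (K + ε) * p (inner A η η)) ?_ ?_
  · refine Tendsto.mono_left ?_ nhdsWithin_le_nhds
    have : Continuous fun ε : ℝ => (K + ε) * p (inner A η η) := by fun_prop
    simpa using this.tendsto 0
  · filter_upwards [self_mem_nhdsWithin] with ε hε
    have hε : 0 < ε := hε
    exact main _ (by linarith) (by linarith)

theorem inner_le (hpos : ∀ ξ : E, p.Nonneg (inner A ξ ξ)) (ξ η : E) :
    p (inner A ξ η) ≤ p.bar (A := A) ξ * p.bar (A := A) η := by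
  refine abs_le_of_sq_le_sq' ?_ (mul_nonneg (bar_nonneg _) (bar_nonneg _)) |>.2
  rw [mul_pow, bar_sq, bar_sq]
  exact inner_sq_le hpos ξ η

theorem bar_add_le (hpos : ∀ ξ : E, p.Nonneg (inner A ξ ξ)) (ξ η : E) :
    p.bar (A := A) (ξ + η) ≤ p.bar (A := A) ξ + p.bar (A := A) η := by
  refine abs_le_of_sq_le_sq' ?_ (add_nonneg (bar_nonneg _) (bar_nonneg _)) |>.2
  rw [bar_sq, InnerRightModule.inner_add_left, InnerRightModule.inner_add_right,
    InnerRightModule.inner_add_right]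
  have h1 := map_add_le_add p.toSeminorm (inner A ξ ξ + inner A ξ η) (inner A η ξ + inner A η η)
  have h2 := map_add_le_add p.toSeminorm (inner A ξ ξ) (inner A ξ η)
  have h3 := map_add_le_add p.toSeminorm (inner A η ξ) (inner A η η)
  have h4 := inner_le hpos ξ η
  have h5 := inner_le hpos η ξ
  have h6 := bar_sq (p := p) ξ
  have h7 := bar_sq (p := p) η
  nlinarith

theorem bar_sum_le (hpos : ∀ ξ : E, p.Nonneg (inner A ξ ξ)) {ι : Type*} (s : Finset ι)
    (f : ι → E) : p.bar (A := A) (∑ i ∈ s, f i) ≤ ∑ i ∈ s, p.bar (A := A) (f i) := by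
  refine Finset.le_sum_of_subadditive _ ?_ (bar_add_le hpos) s f
  simp [bar, InnerRightModule.inner_zero_right]

end ContCStarSeminorm

/-! ### From form bounds to operator bounds. -/

namespace InnerRightModule

variable {A : Type u} [ProCStarAlgebra A] {E : Type v} [AddCommGroup E] [Module ℂ E]

/-- The form `(ξ, η) ↦ ⟨ξ, S η⟩` of a self-adjoint operator `S`. -/
@[reducible] def ofSelfAdjoint [InnerRightModule A E] (S : E →ₗ[ℂ] E)
    (hact : ∀ (ξ : E) (a : A), S (ξ <• a) = S ξ <• a)
    (hS : ∀ ξ η, inner A (S ξ) η = inner A ξ (S η)) : InnerRightModule A E where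
  inner ξ η := inner A ξ (S η)
  add_act := add_act
  act_add := act_add
  act_mul := act_mul
  smul_act := smul_act
  act_smul := act_smul
  inner_add_right ξ η ζ := by rw [map_add, inner_add_right]
  inner_smul_right z ξ η := by rw [map_smul, inner_smul_right]
  inner_act_right ξ η a := by rw [hact, inner_act_right]
  star_inner ξ η := by rw [star_inner, hS]

/-- A self-adjoint operator `S` with `0 ≤ ⟨ξ, S ξ⟩ ≤ r ⟨ξ, ξ⟩` has norm at most `r`. -/
theorem bar_le_of_nonneg_of_le [InnerRightModule A E] {p : ContCStarSeminorm A}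
    (S : E →ₗ[ℂ] E) (hact : ∀ (ξ : E) (a : A), S (ξ <• a) = S ξ <• a)
    (hS : ∀ ξ η, inner A (S ξ) η = inner A ξ (S η)) {r : ℝ} (hr : 0 ≤ r)
    (hpos : ∀ ξ, p.Nonneg (inner A ξ (S ξ)))
    (hle : ∀ ξ, p (inner A ξ (S ξ)) ≤ r * p (inner A ξ ξ)) (ξ : E) :
    p.bar (A := A) (S ξ) ≤ r * p.bar (A := A) ξ := by
  -- Cauchy–Schwarz for the form ⟨·, S·⟩ at ξ and Sξ; it needs only semidefiniteness. As ⟨ξ, SSξ⟩ =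
  -- ⟨Sξ, Sξ⟩, it yields y⁴ ≤ (r x²)(r y²) with x = p̄(ξ), y = p̄(Sξ).
  have h : p (inner A ξ (S (S ξ))) ^ 2 ≤ p (inner A ξ (S ξ)) * p (inner A (S ξ) (S (S ξ))) :=
    letI := ofSelfAdjoint S hact hS
    ContCStarSeminorm.inner_sq_le (E := E) hpos ξ (S ξ)
  rw [← hS] at h
  have h1 := hle ξ
  have h2 := hle (S ξ)
  have hx := ContCStarSeminorm.bar_nonneg (p := p) ξ
  have hy := ContCStarSeminorm.bar_nonneg (p := p) (S ξ)
  rw [← ContCStarSeminorm.bar_sq] at h h1 h2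
  set x := p.bar (A := A) ξ
  set y := p.bar (A := A) (S ξ)
  have h3 : (y ^ 2) ^ 2 ≤ (r * x ^ 2) * (r * y ^ 2) :=
    h.trans (mul_le_mul h1 h2 (apply_nonneg p.toSeminorm _) (by positivity))
  rcases hy.eq_or_lt with h0 | h0
  · rw [← h0]; positivity
  · refine abs_le_of_sq_le_sq' ?_ (by positivity) |>.2
    have : 0 < y ^ 2 := by positivity
    nlinarith

end InnerRightModule

end

section

/-! ### Convergence in a Hilbert module and the Neumann series. -/

namespace HilbertModule

variable {A : Type u} [ProCStarAlgebra A] [PartialOrder A] [StarOrderedRing A]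
  {E : Type v} [AddCommGroup E] [Module ℂ E] [UniformSpace E] [HilbertModule A E]

theorem nonneg_inner_self (p : ContCStarSeminorm A) (ξ : E) : p.Nonneg (inner A ξ ξ) :=
  .of_nonneg (inner_self_nonneg ξ)

variable (A) in
theorem eq_zero_of_bar {ξ : E} (h : ∀ p : ContCStarSeminorm A, p.bar (A := A) ξ = 0) :
    ξ = 0 := by
  refine (inner_self_eq_zero (A := A) ξ).1 (ProCStarAlgebra.eq_zero_of_forall fun p => ?_)
  rw [← ContCStarSeminorm.bar_sq, h p, zero_pow two_ne_zero]

variable (A) in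
theorem eq_of_inner {ξ η : E} (h : ∀ ζ : E, inner A ζ ξ = inner A ζ η) : ξ = η := by
  rw [← sub_eq_zero]
  refine (inner_self_eq_zero (A := A) _).1 ?_
  rw [InnerRightModule.inner_sub_right, h, sub_self]

variable (A) in
theorem tendsto_iff {ι : Type*} {l : Filter ι} {f : ι → E} {ξ : E} :
    Tendsto f l (𝓝 ξ) ↔ ∀ (p : ContCStarSeminorm A) (ε : ℝ), 0 < ε →
      ∀ᶠ i in l, p.bar (A := A) (f i - ξ) < ε := by
  have : IsUniformAddGroup E := HilbertModule.toIsUniformAddGroup A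
  rw [← tendsto_sub_nhds_zero_iff, (nhds_zero_hasBasis (A := A) (E := E)).tendsto_right_iff]
  simp

variable (A) in
theorem exists_tendsto_of_cauchy {f : ℕ → E}
    (h : ∀ (p : ContCStarSeminorm A) (ε : ℝ), 0 < ε → ∃ N, ∀ m, N ≤ m → ∀ n, m ≤ n →
      p.bar (A := A) (f n - f m) < ε) : ∃ ξ, Tendsto f atTop (𝓝 ξ) := by
  have : IsUniformAddGroup E := HilbertModule.toIsUniformAddGroup A
  have : CompleteSpace E := HilbertModule.toCompleteSpace A
  refine cauchySeq_tendsto_of_complete ?_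
  rw [_root_.cauchySeq_iff_tendsto, uniformity_eq_comap_nhds_zero, tendsto_comap_iff, tendsto_iff A]
  intro p ε hε
  obtain ⟨N, hN⟩ := h p ε hε
  filter_upwards [eventually_ge_atTop (N, N)]
  rintro ⟨m, n⟩ ⟨hm, hn⟩
  simp only [Function.comp_apply, Prod.map_apply, sub_zero]
  rcases le_total m n with hmn | hmn
  · exact hN m hm n hmn
  · have := hN n hn m hmn
    rwa [← ContCStarSeminorm.bar_neg, neg_sub] at this

theorem tendsto_inner {ι : Type*} {l : Filter ι} {f : ι → E} {ξ : E} (η : E)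
    (h : Tendsto f l (𝓝 ξ)) : Tendsto (fun i => inner A η (f i)) l (𝓝 (inner A η ξ)) := by
  rw [ProCStarAlgebra.tendsto_iff]
  intro p ε hε
  have hη := ContCStarSeminorm.bar_nonneg (p := p) η
  filter_upwards [(tendsto_iff A).1 h p (ε / (p.bar (A := A) η + 1)) (by positivity)] with i hi
  rw [← InnerRightModule.inner_sub_right]
  refine (ContCStarSeminorm.inner_le (nonneg_inner_self p) _ _).trans_lt ?_
  rw [lt_div_iff₀ (by positivity)] at hi
  nlinarith [ContCStarSeminorm.bar_nonneg (p := p) (f i - ξ)]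

variable (A) in
theorem tendsto_of_bar_le {f g : ℕ → E} {ξ η : E} {M : ℝ} (hg : Tendsto g atTop (𝓝 η))
    (h : ∀ (p : ContCStarSeminorm A) n,
      p.bar (A := A) (f n - ξ) ≤ M * p.bar (A := A) (g n - η)) :
    Tendsto f atTop (𝓝 ξ) := by
  rw [tendsto_iff A]
  intro p ε hε
  filter_upwards [(tendsto_iff A).1 hg p (ε / (|M| + 1)) (by positivity)] with n hn
  refine (h p n).trans_lt ?_
  rw [lt_div_iff₀ (by positivity)] at hn
  nlinarith [ContCStarSeminorm.bar_nonneg (p := p) (g n - η), le_abs_self M]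

variable (A) in
/-- If `S` is linear and `S` contracts all the seminorms by a factor `r < 1`, then `1 - S` is
surjective. -/
theorem exists_sub_eq (S : E →ₗ[ℂ] E) {r : ℝ} (hr : 0 ≤ r) (hr1 : r < 1)
    (hS : ∀ (p : ContCStarSeminorm A) ξ, p.bar (A := A) (S ξ) ≤ r * p.bar (A := A) ξ) (η : E) :
    ∃ ξ, ξ - S ξ = η := by
  have hpow : ∀ (p : ContCStarSeminorm A) n,
      p.bar (A := A) ((S ^ n) η) ≤ r ^ n * p.bar (A := A) η := by
    intro p n
    induction n with
    | zero => simp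
    | succ n ih =>
      rw [pow_succ', Module.End.mul_apply, pow_succ', mul_assoc]
      exact (hS p _).trans (mul_le_mul_of_nonneg_left ih hr)
  have hlim : ∀ (p : ContCStarSeminorm A),
      Tendsto (fun n => r ^ n * p.bar (A := A) η) atTop (𝓝 0) := fun p => by
    simpa using (tendsto_pow_atTop_nhds_zero_of_lt_one hr hr1).mul_const (p.bar (A := A) η)
  have hsum : ∀ p : ContCStarSeminorm A, Summable fun n => r ^ n * p.bar (A := A) η :=
    fun p => (summable_geometric_of_lt_one hr hr1).mul_right _
  -- Partial sums of the Neumann series, dominated in each seminorm by a geometric series.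
  set f : ℕ → E := fun n => ∑ k ∈ Finset.range n, (S ^ k) η with hf
  obtain ⟨ξ, hξ⟩ := exists_tendsto_of_cauchy A (f := f) (fun p ε hε => by
    have hc := (hsum p).hasSum.tendsto_sum_nat.cauchySeq
    obtain ⟨N, hN⟩ := Metric.cauchySeq_iff.1 hc ε hε
    refine ⟨N, fun m hm n hmn => ?_⟩
    have h1 := hN n (hm.trans hmn) m hm
    rw [Real.dist_eq, ← Finset.sum_Ico_eq_sub _ hmn] at h1
    rw [hf, ← Finset.sum_Ico_eq_sub _ hmn]
    refine (ContCStarSeminorm.bar_sum_le (nonneg_inner_self p) _ _).trans_lt ?_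
    exact (Finset.sum_le_sum fun k _ => hpow p k).trans_lt ((le_abs_self _).trans_lt h1))
  refine ⟨ξ, ?_⟩
  have : IsUniformAddGroup E := HilbertModule.toIsUniformAddGroup A
  have hSf : Tendsto (fun n => S (f n)) atTop (𝓝 (S ξ)) :=
    tendsto_of_bar_le A hξ fun p n => by rw [← map_sub]; exact hS p _
  have h1 : Tendsto (fun n => f n - S (f n)) atTop (𝓝 η) := by
    rw [tendsto_iff A]
    intro p ε hε
    filter_upwards [(hlim p).eventually_lt_const hε] with n hn
    have : f n - S (f n) - η = -((S ^ n) η) := by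
      -- The sum telescopes, and the remainder Sⁿη tends to 0 in every seminorm.
      have h2 : ∀ n, f n - S (f n) = η - (S ^ n) η := by
        intro n
        induction n with
        | zero => simp [hf]
        | succ n ih =>
          have h3 : f (n + 1) = f n + (S ^ n) η := Finset.sum_range_succ _ _
          have h4 : (S ^ (n + 1)) η = S ((S ^ n) η) := by
            rw [pow_succ', Module.End.mul_apply]
          rw [h3, map_add, h4, add_sub_add_comm, ih]
          abel
      rw [h2]; abel
    rw [this, ContCStarSeminorm.bar_neg]
    exact (hpow p n).trans_lt hn
  have h2 := hξ.sub hSf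
  -- Pairing with ζ moves the comparison of the two limits into A, which is Hausdorff; definiteness
  -- of the form brings it back to E.
  refine eq_of_inner A fun ζ => ?_
  exact tendsto_nhds_unique (tendsto_inner ζ h2) (tendsto_inner ζ h1)

end HilbertModule

/-! ### The inner product of H_A as a limit of finite sums. -/

namespace HA

variable {A : Type u} [ProCStarAlgebra A]

theorem tendsto_inner_sum (x y : HA A) :
    Tendsto (fun n => ∑ k ∈ Finset.range n, star (x k) * y k) atTop (𝓝 (inner A x y)) := by
  have := (summable_inner x y).hasSum
  rw [← inner_def] at this
  simpa only [HasSum, conditional_filter_eq_map_range, tendsto_map'_iff, Function.comp_def]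
    using this

theorem nonneg_inner_self (p : ContCStarSeminorm A) (x : HA A) : p.Nonneg (inner A x x) :=
  .of_tendsto (tendsto_inner_sum x x) fun _ => .sum _ _ fun _ _ => .star_mul_self _

end HA

end

/-! ### Bounded inverses and complemented ranges. -/

section

variable {A : Type u} [ProCStarAlgebra A]

theorem ContCStarSeminorm.le_mul_of_sub_nonneg {p : ContCStarSeminorm A} {a b : A} {t : ℝ}
    (ht : 0 ≤ t) (ha : p.Nonneg a) (h : p.Nonneg ((t : ℂ) • b - a)) : p a ≤ t * p b := by
  rw [← apply_smul_of_nonneg ht]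
  exact ha.le_of_sub h

theorem ContCStarSeminorm.mul_le_of_sub_nonneg {p : ContCStarSeminorm A} {a b : A} {t : ℝ}
    (ht : 0 ≤ t) (ha : p.Nonneg a) (h : p.Nonneg (b - (t : ℂ) • a)) : t * p a ≤ p b := by
  rw [← apply_smul_of_nonneg ht]
  exact (ha.smul ht).le_of_sub h

namespace Adjointable

variable {E : Type v} [AddCommGroup E] [Module ℂ E] {F : Type*} [AddCommGroup F] [Module ℂ F]

/-- The adjoint is stored as data and the modules need not be definite here, so both maps must be
compared. -/
theorem ext [InnerRightModule A E] [InnerRightModule A F] {S T : Adjointable A E F}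
    (h : ∀ ξ, S ξ = T ξ) (h' : ∀ η, S.adj η = T.adj η) : S = T := by
  obtain ⟨f, g, _, _, _⟩ := S
  obtain ⟨f', g', _, _, _⟩ := T
  obtain rfl : f = f' := LinearMap.ext h
  obtain rfl : g = g' := LinearMap.ext h'
  rfl

theorem mem_boundedPart_of_bar_le [InnerRightModule A E] [InnerRightModule A F]
    {T : Adjointable A E F} {M : ℝ} (hM : 0 ≤ M)
    (h : ∀ (p : ContCStarSeminorm A) ξ, p.bar (A := A) (T ξ) ≤ M * p.bar (A := A) ξ) :
    T ∈ boundedPart A E F := by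
  refine lt_of_le_of_lt (iSup_le fun p => ?_) (ENNReal.coe_lt_top (r := ⟨M, hM⟩))
  exact iInf₂_le (⟨M, hM⟩ : ℝ≥0) (h p)

variable [PartialOrder A] [StarOrderedRing A] [UniformSpace E] [HilbertModule A E]
  [InnerRightModule A F]

/-- A linear map having an adjoint, with values in a Hilbert module, is adjointable. -/
def ofInner (T : E →ₗ[ℂ] F) (hT : ∀ (ξ : E) (a : A), T (ξ <• a) = T ξ <• a) (S : F → E)
    (h : ∀ ξ η, inner A (T ξ) η = inner A ξ (S η)) : Adjointable A E F where
  toLinearMap := T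
  adj :=
    { toFun := S
      -- Linearity of S is automatic: the two sides agree after pairing with every ξ, and the form
      -- on E is definite.
      map_add' := fun η ζ => HilbertModule.eq_of_inner A fun ξ => by
        rw [← h, InnerRightModule.inner_add_right, InnerRightModule.inner_add_right, h, h]
      map_smul' := fun z η => HilbertModule.eq_of_inner A fun ξ => by
        rw [← h, InnerRightModule.inner_smul_right, h, RingHom.id_apply,
          InnerRightModule.inner_smul_right] }
  map_act' := hT
  adj_act' η a := HilbertModule.eq_of_inner A fun ξ => by
    change inner A ξ (S (η <• a)) = inner A ξ (S η <• a)
    rw [← h, InnerRightModule.inner_act_right, InnerRightModule.inner_act_right, h]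
  inner_adj' := h

/-- Let `T` be self-adjoint with `C ⟨ξ, ξ⟩ ≤ ⟨ξ, T ξ⟩ ≤ D ⟨ξ, ξ⟩`, `0 < C ≤ D`. Then `T` is
bounded and has a bounded inverse. -/
theorem isInvertibleInBoundedPart (T : Adjointable A E E) (hT : ∀ ξ, T.adj ξ = T ξ) {C D : ℝ}
    (hC : 0 < C) (hCD : C ≤ D)
    (hlow : ∀ (p : ContCStarSeminorm A) (ξ : E),
      p.Nonneg (inner A ξ (T ξ) - (C : ℂ) • inner A ξ ξ))
    (hupp : ∀ (p : ContCStarSeminorm A) (ξ : E),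
      p.Nonneg ((D : ℂ) • inner A ξ ξ - inner A ξ (T ξ))) :
    T.IsInvertibleInBoundedPart := by
  have hD : 0 < D := hC.trans_le hCD
  have hself : ∀ ξ η, inner A (T ξ) η = inner A ξ (T η) := fun ξ η => by
    rw [T.inner_adj', hT]
  have hpos : ∀ (p : ContCStarSeminorm A) (ξ : E), p.Nonneg (inner A ξ (T ξ)) := fun p ξ => by
    simpa using (hlow p ξ).add ((HilbertModule.nonneg_inner_self p ξ).smul hC.le)
  have hbdd : ∀ (p : ContCStarSeminorm A) ξ, p.bar (A := A) (T ξ) ≤ D * p.bar (A := A) ξ :=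
    fun p ξ => InnerRightModule.bar_le_of_nonneg_of_le T.toLinearMap T.map_act' hself hD.le
      (hpos p) (fun ξ => ContCStarSeminorm.le_mul_of_sub_nonneg hD.le (hpos p ξ) (hupp p ξ)) ξ
  -- C p̄(ξ)² ≤ p⟨ξ, Tξ⟩ ≤ p̄(ξ) p̄(Tξ); divide by p̄(ξ) unless it is 0.
  have hbelow : ∀ (p : ContCStarSeminorm A) ξ,
      p.bar (A := A) ξ ≤ C⁻¹ * p.bar (A := A) (T ξ) := fun p ξ => by
    have h1 := ContCStarSeminorm.mul_le_of_sub_nonneg hC.le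
      (HilbertModule.nonneg_inner_self p ξ) (hlow p ξ)
    have h2 := ContCStarSeminorm.inner_le (HilbertModule.nonneg_inner_self p) ξ (T ξ)
    rw [← ContCStarSeminorm.bar_sq] at h1
    rw [le_inv_mul_iff₀ hC]
    rcases (ContCStarSeminorm.bar_nonneg (p := p) ξ).eq_or_lt with h0 | h0
    · rw [← h0, mul_zero]; exact ContCStarSeminorm.bar_nonneg _
    · nlinarith
  -- Scaling by D⁻¹ places S between 0 and 1 - C/D, and C > 0 makes this factor less than 1 for all
  -- p at once.
  let S : E →ₗ[ℂ] E := LinearMap.id - ((D⁻¹ : ℝ) : ℂ) • T.toLinearMap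
  have hS : ∀ ξ, S ξ = ξ - ((D⁻¹ : ℝ) : ℂ) • T ξ := fun ξ => rfl
  have hinner : ∀ ξ η, inner A ξ (S η) = inner A ξ η - ((D⁻¹ : ℝ) : ℂ) • inner A ξ (T η) := by
    intro ξ η
    rw [hS, InnerRightModule.inner_sub_right, InnerRightModule.inner_smul_right]
  have hDC : (D : ℂ) ≠ 0 := by exact_mod_cast hD.ne'
  have hr : 0 ≤ 1 - D⁻¹ * C := by
    rw [sub_nonneg, inv_mul_le_iff₀ hD]; simpa using hCD
  have hr1 : 1 - D⁻¹ * C < 1 := by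
    have : 0 < D⁻¹ * C := by positivity
    linarith
  have hSpos : ∀ (p : ContCStarSeminorm A) (ξ : E), p.Nonneg (inner A ξ (S ξ)) := fun p ξ => by
    have := (hupp p ξ).smul (inv_nonneg.2 hD.le)
    rwa [smul_sub, smul_smul, ← Complex.ofReal_mul, inv_mul_cancel₀ hD.ne', Complex.ofReal_one,
      one_smul, ← hinner] at this
  have hSbound : ∀ (p : ContCStarSeminorm A) ξ,
      p.bar (A := A) (S ξ) ≤ (1 - D⁻¹ * C) * p.bar (A := A) ξ := fun p ξ => by
    refine InnerRightModule.bar_le_of_nonneg_of_le S ?_ ?_ hr (hSpos p) (fun ξ => ?_) ξ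
    · intro ξ a
      rw [hS, hS, T.map_act', ← InnerRightModule.smul_act, sub_eq_iff_eq_add,
        ← InnerRightModule.add_act, sub_add_cancel]
    · intro ξ η
      rw [hinner, hS, InnerRightModule.inner_sub_left, InnerRightModule.inner_smul_left, hself]
      simp
    · refine ContCStarSeminorm.le_mul_of_sub_nonneg hr (hSpos p ξ) ?_
      have := (hlow p ξ).smul (inv_nonneg.2 hD.le)
      convert this using 1
      rw [hinner]
      push_cast
      module
  have hsurj : Function.Surjective T := fun η => by
    obtain ⟨ξ, hξ⟩ := HilbertModule.exists_sub_eq A S hr hr1 hSbound η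
    refine ⟨((D⁻¹ : ℝ) : ℂ) • ξ, ?_⟩
    rw [map_smul, ← hξ, hS, sub_sub_cancel]
  have hinj : Function.Injective T := fun ξ η hξη => by
    rw [← sub_eq_zero]
    refine HilbertModule.eq_zero_of_bar A fun p => ?_
    refine le_antisymm ((hbelow p _).trans ?_) (ContCStarSeminorm.bar_nonneg _)
    rw [map_sub, hξη, sub_self]
    simp [ContCStarSeminorm.bar, InnerRightModule.inner_zero_right]
  let e : E ≃ₗ[ℂ] E := LinearEquiv.ofBijective T.toLinearMap ⟨hinj, hsurj⟩
  have hTe : ∀ ξ, T (e.symm ξ) = ξ := e.apply_symm_apply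
  have heT : ∀ ξ, e.symm (T ξ) = ξ := e.symm_apply_apply
  -- The inverse of a self-adjoint bijection is its own adjoint.
  let R : Adjointable A E E := ofInner e.symm.toLinearMap
    (fun ξ a => hinj (by
      change T (e.symm (ξ <• a)) = T (e.symm ξ <• a)
      rw [hTe, T.map_act', hTe]))
    e.symm (fun ξ η => by
      change inner A (e.symm ξ) η = inner A ξ (e.symm η)
      rw [← hTe η, ← hself, hTe, hTe])
  refine ⟨mem_boundedPart_of_bar_le hD.le hbdd, R,
    mem_boundedPart_of_bar_le (inv_nonneg.2 hC.le) fun p ξ => ?_, ext heT fun ξ => ?_,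
    ext hTe fun ξ => ?_⟩
  · have := hbelow p (e.symm ξ)
    rwa [hTe] at this
  · change T.adj (e.symm ξ) = ξ
    rw [hT, hTe]
  · change e.symm (T.adj ξ) = ξ
    rw [hT, heT]

/-- If `T⋆ T` is surjective and `⟨T ξ, T ξ⟩ = 0` only for `ξ = 0`, then the range of `T` is an
orthogonal summand. -/
theorem isOrthogonalSummand_range (T : Adjointable A E F)
    (hdef : ∀ ξ, inner A (T ξ) (T ξ) = 0 → ξ = 0)
    (hsurj : Function.Surjective fun ξ => T.adj (T ξ)) :
    IsOrthogonalSummand A (LinearMap.range T.toLinearMap) := by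
  refine ⟨?_, ?_, ?_⟩
  · rintro _ ⟨ξ, rfl⟩ a
    exact ⟨ξ <• a, T.map_act' ξ a⟩
  · rw [Submodule.disjoint_def]
    rintro _ ⟨ξ, rfl⟩ hξ
    rw [hdef ξ (hξ _ ⟨ξ, rfl⟩), map_zero]
  · rw [codisjoint_iff, eq_top_iff]
    intro x _
    -- With T⋆Tξ = T⋆x, the difference x - Tξ is killed by T⋆, hence orthogonal to the range.
    obtain ⟨ξ, hξ⟩ := hsurj (T.adj x)
    refine Submodule.mem_sup.2 ⟨T ξ, ⟨ξ, rfl⟩, x - T ξ, ?_, add_sub_cancel _ _⟩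
    rintro _ ⟨η, rfl⟩
    rw [T.inner_adj', map_sub]
    simp only at hξ
    rw [hξ, sub_self, InnerRightModule.inner_zero_right]

end Adjointable

/-! ### Frame bounds and the synthesis operator x ↦ ∑ hₙ(xₙ). -/

section Frame

variable [PartialOrder A] [StarOrderedRing A] {E : Type v} [AddCommGroup E] [Module ℂ E]
  [UniformSpace E] [HilbertModule A E] (h : ℕ → Multiplier A E) (hh : IsStandardFrame h)

/-- The frame transform as a linear map. -/
def frameTransformLinear : E →ₗ[ℂ] HA A where
  toFun := frameTransform h hh
  map_add' ξ η := HA.ext fun n => map_add (h n).adj ξ η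
  map_smul' z ξ := HA.ext fun n => map_smul (h n).adj z ξ

theorem exists_frame_bounds : ∃ C D : ℝ, 0 < C ∧ C ≤ D ∧ ∀ (p : ContCStarSeminorm A) (ξ : E),
    p.Nonneg (inner A (frameTransform h hh ξ) (frameTransform h hh ξ) - (C : ℂ) • inner A ξ ξ) ∧
    p.Nonneg
      ((D : ℂ) • inner A ξ ξ - inner A (frameTransform h hh ξ) (frameTransform h hh ξ)) := by
  obtain ⟨C, D, hC, -, H⟩ := id hh
  -- The given bounds need not satisfy C ≤ D when E = 0; enlarging D repairs this.
  refine ⟨C, max C D, hC, le_max_left _ _, fun p ξ => ?_⟩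
  obtain ⟨s, hs, h1, h2⟩ := H ξ
  have hs' : inner A (frameTransform h hh ξ) (frameTransform h hh ξ) = s := hs.tsum_eq
  rw [hs']
  refine ⟨.of_nonneg (sub_nonneg.2 h1), ?_⟩
  have h3 : p.Nonneg ((D : ℂ) • inner A ξ ξ - s) := .of_nonneg (sub_nonneg.2 h2)
  have h4 := (HilbertModule.nonneg_inner_self p ξ).smul (sub_nonneg.2 (le_max_right C D))
  convert h3.add h4 using 1
  push_cast
  module

/-- For x in H_A and initial segments s, the right side is a partial sum of ⟨θξ, x⟩; this identifies
synthesis as the adjoint of θ. -/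
theorem inner_sum_frame (x : ℕ → A) (s : Finset ℕ) (ξ : E) :
    inner A ξ (∑ k ∈ s, h k (x k)) = ∑ k ∈ s, star ((h k).adj ξ) * x k := by
  rw [InnerRightModule.inner_sum_right]
  refine Finset.sum_congr rfl fun k _ => ?_
  exact ((h k).adjoint.inner_adj' ξ (x k)).symm

/-- The finite parts of the synthesis operator are controlled by the frame transform. -/
theorem bar_sum_frame_sq_le {D : ℝ} (hD : 0 ≤ D) (p : ContCStarSeminorm A)
    (hbound : ∀ ξ, p.bar (A := A) (frameTransform h hh ξ) ≤ D * p.bar (A := A) ξ)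
    (x : ℕ → A) (s : Finset ℕ) :
    p.bar (A := A) (∑ k ∈ s, h k (x k)) ^ 2 ≤ D ^ 2 * p (∑ k ∈ s, star (x k) * x k) := by
  set ζ := ∑ k ∈ s, h k (x k) with hζ
  have hy : ∀ z : HA A, inner A z (∑ k ∈ s, HA.e k (x k)) = ∑ k ∈ s, star (z k) * x k :=
    fun z => by
      rw [InnerRightModule.inner_sum_right]
      refine Finset.sum_congr rfl fun k _ => ?_
      exact ((HA.e k).adjoint.inner_adj' z (x k)).symm
  -- The truncation of x to s lies in H_A for any sequence x, so ⟨ζ, ζ⟩ can be rewritten as ⟨θζ, y⟩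
  -- and Cauchy–Schwarz applied in H_A.
  set y : HA A := ∑ k ∈ s, HA.e k (x k) with hy_def
  have h1 : inner A ζ ζ = inner A (frameTransform h hh ζ) y := by
    rw [hy]
    exact inner_sum_frame h x s ζ
  have h2 : inner A y y = ∑ k ∈ s, star (x k) * x k := by
    have h3 : inner A y y = ∑ k ∈ s, inner A (HA.e k (x k)) y := by
      rw [← InnerRightModule.star_inner, hy_def, InnerRightModule.inner_sum_right, star_sum]
      simp only [InnerRightModule.star_inner]
    have h4 : ∀ k ∈ s, y k = x k := by
      intro k hk
      have h5 : y k = ∑ j ∈ s, (HA.e j (x j)) k := map_sum ((HA.e (A := A) k).adj) _ s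
      rw [h5, Finset.sum_eq_single k]
      · exact Pi.single_eq_same (M := fun _ : ℕ => A) k (x k)
      · intro j _ hj
        exact Pi.single_eq_of_ne (M := fun _ : ℕ => A) hj.symm (x j)
      · exact fun hk' => absurd hk hk'
    rw [h3]
    refine Finset.sum_congr rfl fun k hk => ?_
    rw [(HA.e k).inner_adj']
    change star (x k) * y k = _
    rw [h4 k hk]
  have h3 := ContCStarSeminorm.inner_le (HA.nonneg_inner_self p) (frameTransform h hh ζ) y
  rw [← h1, ← ContCStarSeminorm.bar_sq] at h3
  rw [← h2, ← ContCStarSeminorm.bar_sq]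
  have h4 := hbound ζ
  have hb := ContCStarSeminorm.bar_nonneg (p := p) ζ
  have hb' := ContCStarSeminorm.bar_nonneg (p := p) y
  rw [← mul_pow]
  refine pow_le_pow_left₀ hb ?_ 2
  rcases hb.eq_or_lt with h0 | h0
  · rw [← h0]; positivity
  · nlinarith

/-- The series `∑ hₙ(xₙ)` converges in `E` for `x ∈ H_A`. -/
theorem exists_tendsto_sum_frame {D : ℝ} (hD : 0 ≤ D)
    (hbound : ∀ (p : ContCStarSeminorm A) ξ,
      p.bar (A := A) (frameTransform h hh ξ) ≤ D * p.bar (A := A) ξ) (x : HA A) :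
    ∃ ξ, Tendsto (fun n => ∑ k ∈ Finset.range n, h k (x k)) atTop (𝓝 ξ) := by
  refine HilbertModule.exists_tendsto_of_cauchy A fun p ε hε => ?_
  have hc := (HA.tendsto_inner_sum x x).cauchySeq
  rw [ProCStarAlgebra.cauchySeq_iff] at hc
  -- The preceding estimate is quadratic, whence ε²; the added 1 covers D = 0.
  obtain ⟨N, hN⟩ := hc p (ε ^ 2 / (D ^ 2 + 1)) (by positivity)
  refine ⟨N, fun m hm n hmn => ?_⟩
  have h1 := hN m hm n hmn
  rw [← Finset.sum_Ico_eq_sub _ hmn] at h1 ⊢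
  rw [lt_div_iff₀ (by positivity)] at h1
  refine lt_of_pow_lt_pow_left₀ 2 hε.le
    ((bar_sum_frame_sq_le h hh hD p (hbound p) x _).trans_lt ?_)
  have := apply_nonneg p.toSeminorm (∑ k ∈ Finset.Ico m n, star (x k) * x k)
  nlinarith

end Frame

end

end HilbertPro

/-! ### The frame transform theorem. -/

theorem theorem3p11 {A : Type*} [ProCStarAlgebra A] [PartialOrder A] [StarOrderedRing A]
    {E : Type*} [AddCommGroup E] [Module ℂ E] [UniformSpace E] [HilbertModule A E]
    (hE : IsCountablyGeneratedInMultipliers A E)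
    (h : ℕ → Multiplier A E) (hh : IsStandardFrame h) :
    ∃ θ : Adjointable A E (HA A),
      (∀ ξ : E, θ ξ = frameTransform h hh ξ) ∧
      θ.IsEmbedding ∧
      IsOrthogonalSummand A (LinearMap.range θ.toLinearMap) ∧
      (∀ n : ℕ, θ.adjoint.comp (HA.e n) = h n) ∧
      (θ.adjoint.comp θ).IsInvertibleInBoundedPart := by
  obtain ⟨C, D, hC, hCD, hb⟩ := exists_frame_bounds h hh
  have hD : 0 < D := hC.trans_le hCD
  have hupp : ∀ (p : ContCStarSeminorm A) ξ,
      p.bar (A := A) (frameTransform h hh ξ) ≤ √D * p.bar (A := A) ξ := fun p ξ => by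
    rw [ContCStarSeminorm.bar, ContCStarSeminorm.bar, ← Real.sqrt_mul hD.le]
    exact Real.sqrt_le_sqrt (ContCStarSeminorm.le_mul_of_sub_nonneg hD.le
      (HA.nonneg_inner_self p _) (hb p ξ).2)
  have hlow : ∀ (p : ContCStarSeminorm A) ξ,
      p.bar (A := A) ξ ≤ (√C)⁻¹ * p.bar (A := A) (frameTransform h hh ξ) := fun p ξ => by
    rw [le_inv_mul_iff₀ (Real.sqrt_pos.2 hC), ContCStarSeminorm.bar, ContCStarSeminorm.bar,
      ← Real.sqrt_mul hC.le]
    exact Real.sqrt_le_sqrt (ContCStarSeminorm.mul_le_of_sub_nonneg hC.le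
      (HilbertModule.nonneg_inner_self p _) (hb p ξ).1)
  -- S x is the limit of the partial sums of ∑ hₙ(xₙ), the candidate for θ⋆x.
  choose S hS using exists_tendsto_sum_frame h hh (Real.sqrt_nonneg D) hupp
  let θ : Adjointable A E (HA A) := Adjointable.ofInner (frameTransformLinear h hh)
    (fun ξ a => HA.ext fun n => (h n).adj_act' ξ a) S fun ξ x => by
      refine tendsto_nhds_unique (HA.tendsto_inner_sum (frameTransform h hh ξ) x) ?_
      have := HilbertModule.tendsto_inner (A := A) ξ (hS x)
      simp only [inner_sum_frame] at this
      exact this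
  have hθ : ∀ ξ, θ ξ = frameTransform h hh ξ := fun _ => rfl
  have hinv : (θ.adjoint.comp θ).IsInvertibleInBoundedPart := by
    have hT : ∀ ξ, inner A ξ ((θ.adjoint.comp θ) ξ) =
        inner A (frameTransform h hh ξ) (frameTransform h hh ξ) :=
      fun ξ => (θ.inner_adj' ξ (θ ξ)).symm
    refine Adjointable.isInvertibleInBoundedPart _ (fun _ => rfl) hC hCD (fun p ξ => ?_)
      fun p ξ => ?_
    · rw [hT]; exact (hb p ξ).1
    · rw [hT]; exact (hb p ξ).2
  -- The lower frame bound gives this directly, without definiteness of H_A.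
  have hdef : ∀ ξ, inner A (θ ξ) (θ ξ) = 0 → ξ = 0 := fun ξ hξ => by
    refine HilbertModule.eq_zero_of_bar A fun p => ?_
    refine le_antisymm ((hlow p ξ).trans ?_) (ContCStarSeminorm.bar_nonneg _)
    rw [ContCStarSeminorm.bar, ← hθ, hξ]
    simp
  refine ⟨θ, hθ, ⟨?_, fun p => ⟨√D, Real.sqrt_pos.2 hD, hupp p⟩,
    fun p => ⟨(√C)⁻¹, inv_pos.2 (Real.sqrt_pos.2 hC), hlow p⟩⟩, ?_, fun n => ?_, hinv⟩
  · refine (injective_iff_map_eq_zero θ.toLinearMap).2 fun ξ hξ => hdef ξ ?_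
    rw [hξ, InnerRightModule.inner_zero_right]
  · obtain ⟨-, R, -, -, hR⟩ := hinv
    refine θ.isOrthogonalSummand_range hdef fun η => ⟨R η, ?_⟩
    exact congrArg (fun T : Adjointable A E E => T η) hR
  -- Against any ξ, both θ⋆(eₙ a) and hₙ a pair to ⟨hₙ, ξ⟩⋆ a; the adjoints agree because the n-th
  -- component of θξ is ⟨hₙ, ξ⟩.
  · refine Adjointable.ext (fun a => HilbertModule.eq_of_inner A fun ξ => ?_) fun _ => rfl
    have h1 : inner A ξ ((θ.adjoint.comp (HA.e n)) a) = inner A (θ ξ) (HA.e n a) :=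
      (θ.inner_adj' ξ (HA.e n a)).symm
    have h2 := (HA.e n).adjoint.inner_adj' (θ ξ) a
    have h3 := (h n).adjoint.inner_adj' ξ a
    exact h1.trans (h2.symm.trans h3)
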